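/- A continuous function $f:\mathbb{R}^d\to\mathbb{R}$ is called piecewise affine if there are finitely many pairs $(y_i,a_i)\in\mathbb{R}^d\times\mathbb{R}$, $i=1,\dots,N$, such that $f(w)\in\{y_1^\top w+a_1,\dots,y_N^\top w+a_N\}$ for every $w\in\mathbb{R}^d$. For a locally Lipschitz function $f$, let $$\partial f(x):=\operatorname{conv}\{s:\ \exists\, x_n\to x \text{ such that } \nabla f(x_n)\text{ exists for all } n \text{ and } \nabla f(x_n)\to s\}$$ denote its Clarke subdifferential at $x$. For sets $A,B\subseteq\mathbb{R}^d$ let $A\pm B:=\{a\pm b: a\in A,\ b\in B\}$ and $\operatorname{par}(A):=\operatorname{span}(A-A)$, and let $\operatorname{ext}$ denote the set of extreme points. Two polytopes (convex hulls of finite sets) $A,B\subseteq\mathbb{R}^d$ are called compatible if, for all $a\in A$ and $b\in B$ with $a-b\in\operatorname{ext}(A-B)$, one has $a+b\in\operatorname{ext}(A+B)$. Proposition (transversality implies the exact sum rule and compatibility). Let $h,g:\mathbb{R}^d\to\mathbb{R}$ be convex piecewise affine functions and let $x\in\mathbb{R}^d$. If $h$ and $g$ are transversal at $x$, that is, if $$\operatorname{par}(\partial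 h(x))\cap\operatorname{par}(\partial g(x))=\{0\},$$ then $$\partial(h-g)(x)=\partial h(x)-\partial g(x),$$ and the sets $\partial h(x)$ and $\partial g(x)$ are compatible polytopes. -/

import Mathlib

open Filter Topology
open scoped Pointwise

namespace PiecewiseAffine

/-- A function on `ℝ^d` is piecewise affine if it is continuous and coincides, at every point,
with one of finitely many affine functions. -/
def IsPiecewiseAffine {d : ℕ} (f : EuclideanSpace ℝ (Fin d) → ℝ) : Prop :=
  Continuous f ∧
    ∃ (N : ℕ) (y : Fin N → EuclideanSpace ℝ (Fin d)) (a : Fin N → ℝ),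
      ∀ w, ∃ i, f w = inner ℝ (y i) w + a i

/-- The Clarke subdifferential (of a locally Lipschitz function) at `x`: the convex hull of all
limits of gradients of `f` along sequences of points of differentiability converging to `x`. -/
def clarkeSubdiff {d : ℕ} (f : EuclideanSpace ℝ (Fin d) → ℝ) (x : EuclideanSpace ℝ (Fin d)) :
    Set (EuclideanSpace ℝ (Fin d)) :=
  convexHull ℝ {s | ∃ u v : ℕ → EuclideanSpace ℝ (Fin d),
    Tendsto u atTop (𝓝 x) ∧ (∀ n, HasGradientAt f (v n) (u n)) ∧ Tendsto v atTop (𝓝 s)}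

/-- The linear subspace parallel to a set `S`, that is, the span of `S - S`. -/
def par {d : ℕ} (S : Set (EuclideanSpace ℝ (Fin d))) :
    Submodule ℝ (EuclideanSpace ℝ (Fin d)) :=
  Submodule.span ℝ (S - S)

/-- `h` and `g` are transversal at `x` if the subspaces parallel to their subdifferentials at `x`
intersect trivially. -/
def Transversal {d : ℕ} (h g : EuclideanSpace ℝ (Fin d) → ℝ)
    (x : EuclideanSpace ℝ (Fin d)) : Prop :=
  par (clarkeSubdiff h x) ⊓ par (clarkeSubdiff g x) = ⊥

/-- A polytope is the convex hull of a finite set of points. -/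
def IsPolytope {d : ℕ} (A : Set (EuclideanSpace ℝ (Fin d))) : Prop :=
  ∃ V : Set (EuclideanSpace ℝ (Fin d)), V.Finite ∧ A = convexHull ℝ V

/-- `A` and `B` are compatible polytopes: both are polytopes and, whenever `a ∈ A` and `b ∈ B` are
such that `a - b` is an extreme point of `A - B`, the sum `a + b` is an extreme point of `A + B`. -/
def CompatiblePolytopes {d : ℕ} (A B : Set (EuclideanSpace ℝ (Fin d))) : Prop :=
  IsPolytope A ∧ IsPolytope B ∧
    ∀ a ∈ A, ∀ b ∈ B, a - b ∈ (A - B).extremePoints ℝ → a + b ∈ (A + B).extremePoints ℝ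

end PiecewiseAffine

/-! Near `x` each function is glued from finitely many affine pieces with full-dimensional closed
domains, and its limiting gradients are the slopes of the pieces through `x`
(`limitingGradients_eq`). Every limiting gradient of `h - g` is therefore a difference of slopes.
Conversely, convexity makes each slope at `x` exposed by some direction: `p` for `y i`, `q` for `z
j`. Transversality yields one `u` acting as `p` on `par (∂h x)` and as `q` on `par (∂g x)`, so just
off `x` along `u` the gradient of `h - g` is `y i - z j`. Convex hulls commute with set differences,
giving the sum rule. Compatibility is uniqueness of decompositions in a direct sum. -/

namespace PiecewiseAffine

variable {d : ℕ} {ι κ : Type*}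

/-- A finite cover of `ℝ^d` by closures of open sets on each of which `f` is affine, the `i`-th
one with gradient `y i`. -/
structure IsAffineCover (f : EuclideanSpace ℝ (Fin d) → ℝ) (y : ι → EuclideanSpace ℝ (Fin d))
    (a : ι → ℝ) (C : ι → Set (EuclideanSpace ℝ (Fin d))) : Prop where
  isClosed : ∀ i, IsClosed (C i)
  subset_closure_interior : ∀ i, C i ⊆ closure (interior (C i))
  exists_mem : ∀ w, ∃ i, w ∈ C i
  eq_on : ∀ i, ∀ w ∈ C i, f w = inner ℝ (y i) w + a i

/-- By Baire, the interiors of the agreement sets have dense union. Passing to closures of interiors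
discards thin pieces, whose slopes need not be gradients. -/
theorem IsPiecewiseAffine.exists_isAffineCover {f : EuclideanSpace ℝ (Fin d) → ℝ}
    (hf : IsPiecewiseAffine f) :
    ∃ (N : ℕ) (y : Fin N → EuclideanSpace ℝ (Fin d)) (a : Fin N → ℝ)
      (C : Fin N → Set (EuclideanSpace ℝ (Fin d))), IsAffineCover f y a C := by
  obtain ⟨hcont, N, y, a, hya⟩ := hf
  have hcl : ∀ i, IsClosed {w | f w = inner ℝ (y i) w + a i} := fun i =>
    isClosed_eq hcont (by fun_prop)
  refine ⟨N, y, a, fun i => closure (interior {w | f w = inner ℝ (y i) w + a i}),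
    fun i => isClosed_closure, fun i => ?_, fun w => ?_, fun i w hw => ?_⟩
  · exact closure_mono (interior_maximal subset_closure isOpen_interior)
  · have hd := dense_iUnion_interior_of_closed hcl
      (Set.eq_univ_of_forall fun w => Set.mem_iUnion.2 (hya w))
    have hw := hd w
    rw [closure_iUnion_of_finite] at hw
    exact Set.mem_iUnion.1 hw
  · exact closure_minimal interior_subset (hcl i) hw

theorem IsAffineCover.dense_iUnion_interior {f : EuclideanSpace ℝ (Fin d) → ℝ}
    {y : ι → EuclideanSpace ℝ (Fin d)} {a : ι → ℝ} {C : ι → Set (EuclideanSpace ℝ (Fin d))}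
    (hf : IsAffineCover f y a C) : Dense (⋃ i, interior (C i)) := by
  intro w
  obtain ⟨i, hi⟩ := hf.exists_mem w
  exact closure_mono (Set.subset_iUnion (fun i => interior (C i)) i)
    (hf.subset_closure_interior i hi)

theorem IsAffineCover.sub [Finite ι] [Finite κ] {f g : EuclideanSpace ℝ (Fin d) → ℝ}
    {y : ι → EuclideanSpace ℝ (Fin d)} {a : ι → ℝ} {C : ι → Set (EuclideanSpace ℝ (Fin d))}
    {z : κ → EuclideanSpace ℝ (Fin d)} {b : κ → ℝ} {D : κ → Set (EuclideanSpace ℝ (Fin d))}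
    (hf : IsAffineCover f y a C) (hg : IsAffineCover g z b D) :
    IsAffineCover (fun w => f w - g w) (fun p : ι × κ => y p.1 - z p.2)
      (fun p => a p.1 - b p.2)
      (fun p => closure (interior (C p.1) ∩ interior (D p.2))) := by
  refine ⟨fun p => isClosed_closure, fun p => ?_, fun w => ?_, fun p w hw => ?_⟩
  · exact closure_mono
      (interior_maximal subset_closure (isOpen_interior.inter isOpen_interior))
  · have hw := hf.dense_iUnion_interior.inter_of_isOpen_left hg.dense_iUnion_interior
      (isOpen_iUnion fun _ => isOpen_interior) w
    simp only [Set.iUnion_inter_iUnion, closure_iUnion_of_finite, Set.mem_iUnion] at hw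
    obtain ⟨i, j, hij⟩ := hw
    exact ⟨(i, j), hij⟩
  · have h1 : w ∈ C p.1 := closure_minimal
      (Set.inter_subset_left.trans interior_subset) (hf.isClosed _) hw
    have h2 : w ∈ D p.2 := closure_minimal
      (Set.inter_subset_right.trans interior_subset) (hg.isClosed _) hw
    simp only [hf.eq_on _ w h1, hg.eq_on _ w h2, inner_sub_left]
    ring

theorem exists_frequently_of_finite {α : Type*} [Finite ι] {l : Filter α} [l.NeBot]
    {P : ι → α → Prop} (h : ∀ᶠ t in l, ∃ i, P i t) : ∃ i, ∃ᶠ t in l, P i t := by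
  by_contra hcon
  push Not at hcon
  obtain ⟨t, ⟨i, hi⟩, hn⟩ := (h.and (eventually_all.2 hcon)).exists
  exact hn i hi

theorem tendsto_slope_of_hasGradientAt {f : EuclideanSpace ℝ (Fin d) → ℝ}
    {s w : EuclideanSpace ℝ (Fin d)} (hs : HasGradientAt f s w) (v : EuclideanSpace ℝ (Fin d)) :
    Tendsto (fun t : ℝ => t⁻¹ * (f (w + t • v) - f w)) (𝓝[>] 0) (𝓝 (inner ℝ s v)) := by
  have h1 : HasLineDerivAt ℝ f (inner ℝ s v) w v := by
    simpa using hs.hasFDerivAt.hasLineDerivAt v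
  simpa using h1.tendsto_slope_zero_right

theorem hasGradientAt_of_eventuallyEq {f : EuclideanSpace ℝ (Fin d) → ℝ}
    {s w : EuclideanSpace ℝ (Fin d)} {c : ℝ} (h : ∀ᶠ p in 𝓝 w, f p = inner ℝ s p + c) :
    HasGradientAt f s w := by
  have h1 : HasFDerivAt (fun p => inner ℝ s p + c) (innerSL ℝ s) w :=
    (innerSL ℝ s).hasFDerivAt.add_const c
  exact (hasGradientAt_iff_hasFDerivAt.2 h1).congr_of_eventuallyEq h

/-- Along each ray some piece recurs at arbitrarily small times, so `s - y i` kills that direction.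
Finitely many proper subspaces cannot cover the space. -/
theorem IsAffineCover.exists_eq_of_hasGradientAt [Finite ι]
    {f : EuclideanSpace ℝ (Fin d) → ℝ}
    {y : ι → EuclideanSpace ℝ (Fin d)} {a : ι → ℝ} {C : ι → Set (EuclideanSpace ℝ (Fin d))}
    (hf : IsAffineCover f y a C) {s w : EuclideanSpace ℝ (Fin d)} (hs : HasGradientAt f s w) :
    ∃ i, w ∈ C i ∧ y i = s := by
  have key : ∀ v, ∃ i, w ∈ C i ∧ inner ℝ (s - y i) v = 0 := by
    intro v
    obtain ⟨i, hi⟩ := exists_frequently_of_finite (l := 𝓝[>] (0 : ℝ))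
      (P := fun i t => w + t • v ∈ C i) (Eventually.of_forall fun t => hf.exists_mem _)
    have hlim : Tendsto (fun t : ℝ => w + t • v) (𝓝[>] 0) (𝓝 w) := by
      have : Continuous fun t : ℝ => w + t • v := by fun_prop
      simpa using (this.tendsto 0).mono_left nhdsWithin_le_nhds
    have hw : w ∈ C i := (hf.isClosed i).mem_of_frequently_of_tendsto hi hlim
    refine ⟨i, hw, ?_⟩
    have hmem : inner ℝ s v ∈ ({inner ℝ (y i) v} : Set ℝ) := by
      refine isClosed_singleton.mem_of_frequently_of_tendsto ?_ (tendsto_slope_of_hasGradientAt hs v)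
      refine (hi.and_eventually self_mem_nhdsWithin).mono ?_
      rintro t ⟨ht, ht0⟩
      have ht0 : (0 : ℝ) < t := ht0
      rw [Set.mem_singleton_iff, hf.eq_on i _ ht, hf.eq_on i _ hw, inner_add_right,
        inner_smul_right]
      field_simp
      ring
    rw [inner_sub_left, Set.mem_singleton_iff.1 hmem, sub_self]
  by_contra hcon
  push Not at hcon
  have hne : ∀ i : {i // w ∈ C i}, LinearMap.ker (innerₛₗ ℝ (s - y i)) ≠ ⊤ := by
    intro i htop
    have hmem : s - y i ∈ LinearMap.ker (innerₛₗ ℝ (s - y i)) := htop ▸ Submodule.mem_top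
    have h0 : inner ℝ (s - y i) (s - y i) = (0 : ℝ) := hmem
    exact hcon i i.2 (sub_eq_zero.1 (inner_self_eq_zero.1 h0)).symm
  obtain ⟨v, hv⟩ := Submodule.exists_forall_notMem_of_forall_ne_top _ hne
  obtain ⟨i, hi, hiv⟩ := key v
  exact hv ⟨i, hi⟩ hiv

/-- The limits of gradients of `f` along sequences converging to `x`. -/
def limitingGradients (f : EuclideanSpace ℝ (Fin d) → ℝ) (x : EuclideanSpace ℝ (Fin d)) :
    Set (EuclideanSpace ℝ (Fin d)) :=
  {s | ∃ u v : ℕ → EuclideanSpace ℝ (Fin d),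
    Tendsto u atTop (𝓝 x) ∧ (∀ n, HasGradientAt f (v n) (u n)) ∧ Tendsto v atTop (𝓝 s)}

theorem clarkeSubdiff_eq_convexHull (f : EuclideanSpace ℝ (Fin d) → ℝ)
    (x : EuclideanSpace ℝ (Fin d)) :
    clarkeSubdiff f x = convexHull ℝ (limitingGradients f x) := rfl

/-! ### Slopes of a convex function at a point -/

section

variable {f : EuclideanSpace ℝ (Fin d) → ℝ}
  {y : ι → EuclideanSpace ℝ (Fin d)} {a : ι → ℝ} {C : ι → Set (EuclideanSpace ℝ (Fin d))}

theorem IsAffineCover.limitingGradients_eq [Finite ι] (hf : IsAffineCover f y a C)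
    (x : EuclideanSpace ℝ (Fin d)) :
    limitingGradients f x = y '' {i | x ∈ C i} := by
  ext s
  constructor
  · rintro ⟨u, v, hu, huv, hv⟩
    obtain ⟨i, hi⟩ := exists_frequently_of_finite (l := atTop)
      (P := fun i n => u n ∈ C i ∧ y i = v n)
      (Eventually.of_forall fun n => hf.exists_eq_of_hasGradientAt (huv n))
    have hs : s ∈ ({y i} : Set _) := isClosed_singleton.mem_of_frequently_of_tendsto
      (hi.mono fun n hn => hn.2.symm) hv
    exact ⟨i, (hf.isClosed i).mem_of_frequently_of_tendsto (hi.mono fun n hn => hn.1) hu,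
      hs.symm⟩
  · rintro ⟨i, hi, rfl⟩
    obtain ⟨u, hu, hlim⟩ := mem_closure_iff_seq_limit.1 (hf.subset_closure_interior i hi)
    refine ⟨u, fun _ => y i, hlim, fun n => ?_, tendsto_const_nhds⟩
    exact hasGradientAt_of_eventuallyEq
      (Filter.mem_of_superset (mem_interior_iff_mem_nhds.1 (hu n)) (hf.eq_on i))

theorem IsAffineCover.le_of_convexOn (hf : IsAffineCover f y a C)
    (hconv : ConvexOn ℝ Set.univ f) {i : ι} {x : EuclideanSpace ℝ (Fin d)} (hx : x ∈ C i)
    (w : EuclideanSpace ℝ (Fin d)) : inner ℝ (y i) w + a i ≤ f w := by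
  obtain ⟨q, hq⟩ := closure_nonempty_iff.1 ⟨x, hf.subset_closure_interior i hx⟩
  have hconv' : ConvexOn ℝ Set.univ fun w => f w - inner ℝ (y i) w :=
    hconv.sub ((innerₛₗ ℝ (y i)).concaveOn convex_univ)
  -- The difference is constant near `q`, and a local minimum of a convex function is global.
  have hmin : IsLocalMin (fun w => f w - inner ℝ (y i) w) q := by
    filter_upwards [mem_interior_iff_mem_nhds.1 hq] with p hp
    simp [hf.eq_on i p hp, hf.eq_on i q (interior_subset hq)]
  have := IsMinOn.of_isLocalMin_of_convex_univ hmin hconv' w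
  simp only [hf.eq_on i q (interior_subset hq)] at this
  linarith

theorem IsAffineCover.exists_exposing_direction (hf : IsAffineCover f y a C)
    (hconv : ConvexOn ℝ Set.univ f) {i : ι} {x : EuclideanSpace ℝ (Fin d)} (hx : x ∈ C i) :
    ∃ p : EuclideanSpace ℝ (Fin d), ∀ k, x ∈ C k → y k ≠ y i → 0 < inner ℝ p (y i - y k) := by
  obtain ⟨q, hq⟩ := closure_nonempty_iff.1 ⟨x, hf.subset_closure_interior i hx⟩
  -- Pieces `i` and `k` agree at `x`, and piece `i` dominates piece `k` even at `q - t • (y i - y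
  -- k)`; this slack makes the inequality strict.
  refine ⟨q - x, fun k hk hne => ?_⟩
  have hcont : Tendsto (fun t : ℝ => q - t • (y i - y k)) (𝓝[>] 0) (𝓝 q) := by
    have : Continuous fun t : ℝ => q - t • (y i - y k) := by fun_prop
    simpa using (this.tendsto 0).mono_left nhdsWithin_le_nhds
  obtain ⟨t, ht, ht0⟩ := ((hcont.eventually (mem_interior_iff_mem_nhds.1 hq)).and
    self_mem_nhdsWithin).exists
  have ht0 : (0 : ℝ) < t := ht0
  have hle := hf.le_of_convexOn hconv hk (q - t • (y i - y k))
  rw [hf.eq_on i _ ht] at hle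
  have hxx := (hf.eq_on i x hx).symm.trans (hf.eq_on k x hk)
  have hpos : 0 < inner ℝ (y i - y k) (y i - y k) :=
    real_inner_self_pos.2 (sub_ne_zero.2 hne.symm)
  have hmul := mul_pos ht0 hpos
  rw [real_inner_comm]
  simp only [inner_sub_left, inner_sub_right, inner_smul_right] at hle hxx hmul ⊢
  linarith

theorem IsAffineCover.eventually_hasGradientAt [Finite ι] (hf : IsAffineCover f y a C)
    (hconv : ConvexOn ℝ Set.univ f) {i : ι} {x u : EuclideanSpace ℝ (Fin d)} (hx : x ∈ C i)
    (hu : ∀ k, x ∈ C k → y k ≠ y i → 0 < inner ℝ u (y i - y k)) :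
    ∀ᶠ t in 𝓝[>] (0 : ℝ), HasGradientAt f (y i) (x + t • u) := by
  have hnear : ∀ᶠ w in 𝓝 x, ∀ k, w ∈ C k → x ∈ C k := by
    refine eventually_all.2 fun k => ?_
    by_cases hk : x ∈ C k
    · exact Eventually.of_forall fun _ _ => hk
    · filter_upwards [(hf.isClosed k).isOpen_compl.mem_nhds hk] with w hw hw'
      exact absurd hw' hw
  have hlim : Tendsto (fun t : ℝ => x + t • u) (𝓝[>] 0) (𝓝 x) := by
    have : Continuous fun t : ℝ => x + t • u := by fun_prop
    simpa using (this.tendsto 0).mono_left nhdsWithin_le_nhds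
  filter_upwards [hlim.eventually hnear.eventually_nhds, self_mem_nhdsWithin] with t ht ht0
  have ht0 : (0 : ℝ) < t := ht0
  have hstrict : ∀ᶠ w in 𝓝 (x + t • u), ∀ k, x ∈ C k → y k ≠ y i →
      0 < inner ℝ (w - x) (y i - y k) := by
    refine eventually_all.2 fun k => ?_
    by_cases hk : x ∈ C k ∧ y k ≠ y i
    · have hc : Continuous fun w : EuclideanSpace ℝ (Fin d) => inner ℝ (w - x) (y i - y k) := by
        fun_prop
      have h0 : (0 : ℝ) < inner ℝ (x + t • u - x) (y i - y k) := by
        rw [add_sub_cancel_left, real_inner_smul_left]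
        exact mul_pos ht0 (hu k hk.1 hk.2)
      filter_upwards [hc.continuousAt.eventually (lt_mem_nhds h0)] with w hw _ _ using hw
    · exact Eventually.of_forall fun _ h1 h2 => absurd ⟨h1, h2⟩ hk
  refine hasGradientAt_of_eventuallyEq (c := a i) ?_
  filter_upwards [ht, hstrict] with w hw hws
  obtain ⟨k, hk⟩ := hf.exists_mem w
  have hxk := hw k hk
  have hxx := (hf.eq_on i x hx).symm.trans (hf.eq_on k x hxk)
  have hle := hf.le_of_convexOn hconv hx w
  -- A piece of another slope would lie strictly below piece `i` at `w`, contradicting `hle`.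
  rw [hf.eq_on k w hk] at hle ⊢
  by_cases hki : y k = y i
  · rw [hki] at hxx ⊢
    linarith
  · have hlt := hws k hxk hki
    rw [real_inner_comm] at hlt
    simp only [inner_sub_left, inner_sub_right] at hlt
    linarith

end

/-! ### Consequences of transversality -/

theorem exists_inner_eq_on_of_inf_eq_bot {W₁ W₂ : Submodule ℝ (EuclideanSpace ℝ (Fin d))}
    (h : W₁ ⊓ W₂ = ⊥) (p q : EuclideanSpace ℝ (Fin d)) :
    ∃ u : EuclideanSpace ℝ (Fin d), (∀ w ∈ W₁, inner ℝ u w = inner ℝ p w) ∧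
      ∀ w ∈ W₂, inner ℝ u w = inner ℝ q w := by
  have htop : W₁ᗮ ⊔ W₂ᗮ = ⊤ := by
    rw [← Submodule.orthogonal_eq_bot_iff, ← Submodule.inf_orthogonal,
      Submodule.orthogonal_orthogonal, Submodule.orthogonal_orthogonal, h]
  obtain ⟨α, hα, β, hβ, hsum⟩ := Submodule.mem_sup.1
    (htop ▸ Submodule.mem_top : p - q ∈ W₁ᗮ ⊔ W₂ᗮ)
  -- Since `p - q = α + β`, this vector is also `q + β`.
  refine ⟨p - α, fun w hw => ?_, fun w hw => ?_⟩
  · rw [inner_sub_left, Submodule.inner_left_of_mem_orthogonal hw hα, sub_zero]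
  · have : p - α = q + β := by
      rw [eq_sub_iff_add_eq] at hsum
      rw [← hsum]
      abel
    rw [this, inner_add_left, Submodule.inner_left_of_mem_orthogonal hw hβ, add_zero]

theorem sub_mem_par {S : Set (EuclideanSpace ℝ (Fin d))} {a b : EuclideanSpace ℝ (Fin d)}
    (ha : a ∈ S) (hb : b ∈ S) : a - b ∈ par S :=
  Submodule.subset_span (Set.sub_mem_sub ha hb)

theorem add_mem_extremePoints_of_par_inf_eq_bot {A B : Set (EuclideanSpace ℝ (Fin d))}
    (hA : Convex ℝ A) (hB : Convex ℝ B) (h : par A ⊓ par B = ⊥)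
    {a b : EuclideanSpace ℝ (Fin d)} (ha : a ∈ A) (hb : b ∈ B)
    (hab : a - b ∈ (A - B).extremePoints ℝ) : a + b ∈ (A + B).extremePoints ℝ := by
  have hdisj : ∀ {a₁ b₁ a₂ b₂ : EuclideanSpace ℝ (Fin d)}, a₁ ∈ A → a₂ ∈ A → b₁ ∈ B → b₂ ∈ B →
      a₁ - a₂ = b₁ - b₂ → a₁ = a₂ ∧ b₁ = b₂ := by
    intro a₁ b₁ a₂ b₂ h1 h2 h3 h4 he
    have hmem : a₁ - a₂ ∈ par A ⊓ par B := ⟨sub_mem_par h1 h2, he ▸ sub_mem_par h3 h4⟩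
    rw [h, Submodule.mem_bot] at hmem
    exact ⟨sub_eq_zero.1 hmem, sub_eq_zero.1 (he ▸ hmem)⟩
  refine mem_extremePoints_iff_left.2 ⟨Set.add_mem_add ha hb, ?_⟩
  rintro _ ⟨a₁, ha₁, b₁, hb₁, rfl⟩ _ ⟨a₂, ha₂, b₂, hb₂, rfl⟩ ⟨t, s, ht, hs, hts, hcomb⟩
  -- The combination of sums splits into its `A` and `B` parts, so it survives a change of sign on
  -- `B`.
  obtain ⟨ha', hb'⟩ := hdisj (hA ha₁ ha₂ ht.le hs.le hts) ha hb (hB hb₁ hb₂ ht.le hs.le hts) (by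
    simp only [smul_add] at hcomb
    rw [sub_eq_sub_iff_add_eq_add, add_comm b, ← hcomb]
    abel)
  have heq : a₁ - b₁ = a - b := (mem_extremePoints_iff_left.1 hab).2 _ (Set.sub_mem_sub ha₁ hb₁) _
    (Set.sub_mem_sub ha₂ hb₂) ⟨t, s, ht, hs, hts, by
      rw [← ha', hb', smul_sub, smul_sub]
      abel⟩
  obtain ⟨rfl, rfl⟩ := hdisj ha₁ ha hb₁ hb (sub_eq_sub_iff_sub_eq_sub.1 heq)
  rfl

theorem isPolytope_clarkeSubdiff {f : EuclideanSpace ℝ (Fin d) → ℝ} (hf : IsPiecewiseAffine f)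
    (x : EuclideanSpace ℝ (Fin d)) : IsPolytope (clarkeSubdiff f x) := by
  obtain ⟨N, y, a, C, hC⟩ := hf.exists_isAffineCover
  exact ⟨limitingGradients f x, hC.limitingGradients_eq x ▸ Set.toFinite _, rfl⟩

theorem limitingGradients_sub_eq {h g : EuclideanSpace ℝ (Fin d) → ℝ}
    (hh : IsPiecewiseAffine h) (hhc : ConvexOn ℝ Set.univ h)
    (hg : IsPiecewiseAffine g) (hgc : ConvexOn ℝ Set.univ g)
    {x : EuclideanSpace ℝ (Fin d)} (htrans : Transversal h g x) :
    limitingGradients (fun w => h w - g w) x = limitingGradients h x - limitingGradients g x := by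
  obtain ⟨N, y, a, C, hC⟩ := hh.exists_isAffineCover
  obtain ⟨M, z, b, D, hD⟩ := hg.exists_isAffineCover
  have hyS : ∀ k, x ∈ C k → y k ∈ clarkeSubdiff h x := fun k hk =>
    subset_convexHull ℝ _ (by
      change y k ∈ limitingGradients h x
      rw [hC.limitingGradients_eq]
      exact ⟨k, hk, rfl⟩)
  have hzS : ∀ k, x ∈ D k → z k ∈ clarkeSubdiff g x := fun k hk =>
    subset_convexHull ℝ _ (by
      change z k ∈ limitingGradients g x
      rw [hD.limitingGradients_eq]
      exact ⟨k, hk, rfl⟩)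
  apply Set.Subset.antisymm
  · rw [(hC.sub hD).limitingGradients_eq, hC.limitingGradients_eq, hD.limitingGradients_eq]
    rintro _ ⟨⟨i, j⟩, hx, rfl⟩
    exact Set.sub_mem_sub
      ⟨i, closure_minimal (Set.inter_subset_left.trans interior_subset) (hC.isClosed _) hx, rfl⟩
      ⟨j, closure_minimal (Set.inter_subset_right.trans interior_subset) (hD.isClosed _) hx, rfl⟩
  · rw [hC.limitingGradients_eq, hD.limitingGradients_eq]
    rintro _ ⟨_, ⟨i, hi, rfl⟩, _, ⟨j, hj, rfl⟩, rfl⟩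
    obtain ⟨p, hp⟩ := hC.exists_exposing_direction hhc hi
    obtain ⟨q, hq⟩ := hD.exists_exposing_direction hgc hj
    obtain ⟨u, hu₁, hu₂⟩ := exists_inner_eq_on_of_inf_eq_bot htrans p q
    have hgrad : ∀ᶠ t in 𝓝[>] (0 : ℝ),
        HasGradientAt (fun w => h w - g w) (y i - z j) (x + t • u) := by
      filter_upwards [hC.eventually_hasGradientAt hhc hi fun k hk hne =>
          hu₁ _ (sub_mem_par (hyS i hi) (hyS k hk)) ▸ hp k hk hne,
        hD.eventually_hasGradientAt hgc hj fun k hk hne =>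
          hu₂ _ (sub_mem_par (hzS j hj) (hzS k hk)) ▸ hq k hk hne] with t h1 h2
      rw [hasGradientAt_iff_hasFDerivAt, map_sub]
      exact h1.hasFDerivAt.sub h2.hasFDerivAt
    have hlim : Tendsto (fun t : ℝ => x + t • u) (𝓝[>] 0) (𝓝 x) := by
      have : Continuous fun t : ℝ => x + t • u := by fun_prop
      simpa using (this.tendsto 0).mono_left nhdsWithin_le_nhds
    obtain ⟨t, ht, htg⟩ := exists_seq_forall_of_frequently hgrad.frequently
    exact ⟨fun n => x + t n • u, fun _ => y i - z j, hlim.comp ht, htg, tendsto_const_nhds⟩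

end PiecewiseAffine

theorem mainTheorem6 {d : ℕ} (h g : EuclideanSpace ℝ (Fin d) → ℝ)
    (hh : PiecewiseAffine.IsPiecewiseAffine h) (hhc : ConvexOn ℝ Set.univ h)
    (hg : PiecewiseAffine.IsPiecewiseAffine g) (hgc : ConvexOn ℝ Set.univ g)
    (x : EuclideanSpace ℝ (Fin d)) (htrans : PiecewiseAffine.Transversal h g x) :
    PiecewiseAffine.clarkeSubdiff (fun w => h w - g w) x =
        PiecewiseAffine.clarkeSubdiff h x - PiecewiseAffine.clarkeSubdiff g x ∧
      PiecewiseAffine.CompatiblePolytopes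
        (PiecewiseAffine.clarkeSubdiff h x) (PiecewiseAffine.clarkeSubdiff g x) := by
  refine ⟨?_, PiecewiseAffine.isPolytope_clarkeSubdiff hh x,
    PiecewiseAffine.isPolytope_clarkeSubdiff hg x, fun a ha b hb hab => ?_⟩
  · simp only [PiecewiseAffine.clarkeSubdiff_eq_convexHull]
    rw [PiecewiseAffine.limitingGradients_sub_eq hh hhc hg hgc htrans, convexHull_sub]
  · exact PiecewiseAffine.add_mem_extremePoints_of_par_inf_eq_bot (convex_convexHull ℝ _)
      (convex_convexHull ℝ _) htrans ha hb hab
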